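/- For a function $f$ from a metric space $(X,\rho)$ to a real Banach space $V$ let \[ L(f)=\sup\{\|f(x)-f(y)\|/\rho(x,y) : x,y\in X,\ x\neq y\}\in[0,\infty] \] be its Lipschitz constant (with $L(f)=0$ if $X$ has at most one point). Let $\mathcal{LE}(V)\in[0,\infty]$ be the infimum of the constants $c\in[0,\infty)$ such that for every metric space $(Z,\rho)$, every subset $X\subseteq Z$ and every function $f:X\to V$ there is an extension $g:Z\to V$ of $f$ with $L(g)\le c\,L(f)$; if there is no such $c$, then $\mathcal{LE}(V)=\infty$. **Theorem 5.3.** Let $(M,d)$ be any metric space, and let $C_u(M)$ be the Banach space of all bounded uniformly continuous real-valued functions on $M$ with the supremum norm. Then $\mathcal{LE}(C_u(M))\le 37$. -/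

import Mathlib

open scoped NNReal ENNReal BoundedContinuousFunction

universe u v

/-- The Lipschitz constant `L(f) = sup {‖f x - f y‖ / ρ(x, y) : x ≠ y}` of a function from a
metric space to a normed space, as an element of `[0, ∞]`. -/
noncomputable def lipConst {X : Type*} {V : Type*} [MetricSpace X] [NormedAddCommGroup V]
    (f : X → V) : ℝ≥0∞ :=
  ⨆ (x : X) (y : X) (_ : x ≠ y), ENNReal.ofReal (‖f x - f y‖ / dist x y)

/-- The constant `c` is admissible for `V`: for every metric space `Z`, every subset `X` of `Z`
and every function `f : X → V` there is an extension `g` of `f` to `Z` with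
`L(g) ≤ c * L(f)`. -/
def IsLipExtensionBound (V : Type u) [NormedAddCommGroup V] [NormedSpace ℝ V]
    [CompleteSpace V] (c : ℝ≥0) : Prop :=
  ∀ (Z : Type v) [MetricSpace Z] (X : Set Z) (f : X → V),
    ∃ g : Z → V, (∀ x : X, g x = f x) ∧ lipConst g ≤ (c : ℝ≥0∞) * lipConst f

/-- The Lipschitz extension constant of a Banach space `V`: the infimum of the admissible
constants, equal to `∞` if there are none. -/
noncomputable def lipExtensionConst (V : Type u) [NormedAddCommGroup V] [NormedSpace ℝ V]
    [CompleteSpace V] : ℝ≥0∞ :=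
  ⨅ (c : ℝ≥0) (_ : IsLipExtensionBound.{u, v} V c), (c : ℝ≥0∞)

/-- The space of bounded uniformly continuous real functions on `M`, as a subspace of the bounded
continuous functions with the supremum norm. -/
def BddUnifCont (M : Type*) [MetricSpace M] : Submodule ℝ (M →ᵇ ℝ) where
  carrier := {f | UniformContinuous f}
  add_mem' {f g} hf hg := by
    have hf' : UniformContinuous f := hf
    have hg' : UniformContinuous g := hg
    exact hf'.add hg'
  zero_mem' := uniformContinuous_const
  smul_mem' r f hf := by
    have hf' : UniformContinuous f := hf
    exact hf'.const_smul r

theorem isClosed_bddUnifCont (M : Type*) [MetricSpace M] :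
    IsClosed (BddUnifCont M : Set (M →ᵇ ℝ)) := by
  rw [← isSeqClosed_iff_isClosed]
  intro F f hF hlim
  rw [BoundedContinuousFunction.tendsto_iff_tendstoUniformly] at hlim
  exact hlim.uniformContinuous (Filter.Frequently.of_forall hF)

instance instCompleteSpaceBddUnifCont (M : Type*) [MetricSpace M] :
    CompleteSpace (BddUnifCont M) :=
  (isClosed_bddUnifCont M).completeSpace_coe

/-! Coordinatewise McShane extension lets every Lipschitz map into `ℓ_∞(M)` extend with the same
constant, so a 5-Lipschitz retraction of `ℓ_∞(M)` onto `C_u(M)` gives the bound 5, better than 37.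
The retraction is `f ↦ sup_y (f y - ω_f (d(x,y)))`, with `ω_f` the concave modulus minus its value
at `0`. Since `ω_f` is nondecreasing, subadditive and tends to `0` at `0`, it is a modulus of
continuity for the image (`uniformRegularization_sub_le`). For uniformly continuous `f` nothing is
subtracted, and `f` is fixed (`uniformRegularization_eq`). -/

/-- The affine functions `t ↦ a + b * t` with nonnegative coefficients which bound the oscillation
of `f` at distance `t`. -/
def affineMajorants {M : Type*} [MetricSpace M] (f : M → ℝ) : Set (ℝ × ℝ) :=
  {p | 0 ≤ p.1 ∧ 0 ≤ p.2 ∧ ∀ x y, f x - f y ≤ p.1 + p.2 * dist x y}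

/-- The concave majorant of the modulus of continuity of `f`. Its value at `0` measures how far
`f` is from being uniformly continuous. -/
noncomputable def concaveModulus {M : Type*} [MetricSpace M] (f : M → ℝ) (t : ℝ) : ℝ :=
  ⨅ p : affineMajorants f, (p.1.1 + p.1.2 * t)

/-- The concave majorant of the modulus of continuity, shifted so as to vanish at `0`. -/
noncomputable def reducedModulus {M : Type*} [MetricSpace M] (f : M → ℝ) (t : ℝ) : ℝ :=
  concaveModulus f t - concaveModulus f 0

/-- The sup-convolution of `f` with its reduced modulus. -/
noncomputable def uniformRegularization {M : Type*} [MetricSpace M] (f : M → ℝ) (x : M) : ℝ :=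
  ⨆ y, (f y - reducedModulus f (dist x y))

section Regularization

variable {M : Type*} [MetricSpace M] {f h : M → ℝ} {C : ℝ}

theorem nonempty_affineMajorants (hf : ∀ x, |f x| ≤ C) : Nonempty (affineMajorants f) := by
  refine ⟨⟨(2 * |C|, 0), by positivity, le_rfl, fun x y => ?_⟩⟩
  have hx := abs_le.1 ((hf x).trans (le_abs_self C))
  have hy := abs_le.1 ((hf y).trans (le_abs_self C))
  simp only [zero_mul, add_zero]
  linarith

theorem concaveModulus_le {p : ℝ × ℝ} (hp : p ∈ affineMajorants f) {t : ℝ} (ht : 0 ≤ t) :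
    concaveModulus f t ≤ p.1 + p.2 * t := by
  refine ciInf_le (f := fun q : affineMajorants f => q.1.1 + q.1.2 * t) ⟨0, ?_⟩ ⟨p, hp⟩
  rintro _ ⟨⟨q, h1, h2, -⟩, rfl⟩
  exact add_nonneg h1 (mul_nonneg h2 ht)

theorem le_concaveModulus (hf : ∀ x, |f x| ≤ C) {t r : ℝ}
    (hr : ∀ p ∈ affineMajorants f, r ≤ p.1 + p.2 * t) : r ≤ concaveModulus f t := by
  have := nonempty_affineMajorants hf
  exact le_ciInf fun p => hr p.1 p.2

theorem exists_affineMajorant_lt (hf : ∀ x, |f x| ≤ C) (t : ℝ) {ε : ℝ} (hε : 0 < ε) :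
    ∃ p ∈ affineMajorants f, p.1 + p.2 * t < concaveModulus f t + ε := by
  by_contra! H
  linarith [le_concaveModulus hf H]

theorem reducedModulus_zero : reducedModulus f 0 = 0 := sub_self _

theorem reducedModulus_mono (hf : ∀ x, |f x| ≤ C) {s t : ℝ} (hs : 0 ≤ s) (hst : s ≤ t) :
    reducedModulus f s ≤ reducedModulus f t := by
  refine sub_le_sub_right (le_concaveModulus hf fun p hp => ?_) _
  have := mul_le_mul_of_nonneg_left hst hp.2.1
  linarith [concaveModulus_le hp hs]

theorem reducedModulus_nonneg (hf : ∀ x, |f x| ≤ C) {t : ℝ} (ht : 0 ≤ t) :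
    0 ≤ reducedModulus f t := by
  simpa only [reducedModulus_zero] using reducedModulus_mono hf le_rfl ht

/-- Of two majorants nearly optimal at `s` and at `t`, the one of smaller slope bounds the value at
`s + t`, and the intercept of the other bounds the value at `0`. -/
theorem reducedModulus_add_le (hf : ∀ x, |f x| ≤ C) {s t : ℝ} (hs : 0 ≤ s) (ht : 0 ≤ t) :
    reducedModulus f (s + t) ≤ reducedModulus f s + reducedModulus f t := by
  refine le_of_forall_pos_le_add fun ε hε => ?_
  obtain ⟨p, hp, hps⟩ := exists_affineMajorant_lt hf s (half_pos hε)
  obtain ⟨q, hq, hqt⟩ := exists_affineMajorant_lt hf t (half_pos hε)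
  simp only [reducedModulus]
  rcases le_total p.2 q.2 with hpq | hpq
  · have h1 := concaveModulus_le hp (add_nonneg hs ht)
    have h2 := concaveModulus_le hq le_rfl
    have h3 := mul_le_mul_of_nonneg_right hpq ht
    linarith
  · have h1 := concaveModulus_le hq (add_nonneg hs ht)
    have h2 := concaveModulus_le hp le_rfl
    have h3 := mul_le_mul_of_nonneg_right hpq hs
    linarith

theorem exists_reducedModulus_lt (hf : ∀ x, |f x| ≤ C) {ε : ℝ} (hε : 0 < ε) :
    ∃ δ > 0, ∀ t, 0 ≤ t → t < δ → reducedModulus f t < ε := by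
  obtain ⟨p, hp, hlt⟩ := exists_affineMajorant_lt hf 0 (half_pos hε)
  -- The slope may be `0`; adding `1` makes it a legitimate divisor.
  have hb : 0 < p.2 + 1 := by linarith [hp.2.1]
  refine ⟨ε / 2 / (p.2 + 1), by positivity, fun t ht htδ => ?_⟩
  have h1 := concaveModulus_le hp ht
  have h2 : t * (p.2 + 1) < ε / 2 := (lt_div_iff₀ hb).1 htδ
  simp only [reducedModulus]
  linarith

/-- Raising the intercept by `2 * δ` turns a majorant for `f` into one for `h`. -/
theorem concaveModulus_le_add (hf : ∀ x, |f x| ≤ C) {δ : ℝ} (hδ : 0 ≤ δ)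
    (hfh : ∀ x, |f x - h x| ≤ δ) {t : ℝ} (ht : 0 ≤ t) :
    concaveModulus h t ≤ concaveModulus f t + 2 * δ := by
  rw [← sub_le_iff_le_add]
  refine le_concaveModulus hf fun p hp => ?_
  have hp' : (p.1 + 2 * δ, p.2) ∈ affineMajorants h := by
    refine ⟨by linarith [hp.1], hp.2.1, fun x y => ?_⟩
    have hx := abs_le.1 (hfh x)
    have hy := abs_le.1 (hfh y)
    linarith [hp.2.2 x y]
  linarith [concaveModulus_le hp' ht]

theorem reducedModulus_le_add {C' : ℝ} (hf : ∀ x, |f x| ≤ C) (hh : ∀ x, |h x| ≤ C') {δ : ℝ}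
    (hδ : 0 ≤ δ) (hfh : ∀ x, |f x - h x| ≤ δ) {t : ℝ} (ht : 0 ≤ t) :
    reducedModulus h t ≤ reducedModulus f t + 4 * δ := by
  have h1 := concaveModulus_le_add hf hδ hfh ht
  have h2 := concaveModulus_le_add hh hδ (fun x => by rw [abs_sub_comm]; exact hfh x)
    (le_refl (0 : ℝ))
  simp only [reducedModulus]
  linarith

theorem sub_le_concaveModulus (hf : ∀ x, |f x| ≤ C) (x y : M) :
    f x - f y ≤ concaveModulus f (dist x y) :=
  le_concaveModulus hf fun _ hp => hp.2.2 x y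

theorem concaveModulus_zero_of_uniformContinuous (hf : ∀ x, |f x| ≤ C)
    (hu : UniformContinuous f) : concaveModulus f 0 = 0 := by
  refine le_antisymm (le_of_forall_pos_le_add fun ε hε => ?_)
    (le_concaveModulus hf fun p hp => by linarith [hp.1])
  obtain ⟨δ, hδ, H⟩ := Metric.uniformContinuous_iff.1 hu ε hε
  -- Below distance `δ` the intercept suffices; beyond it the linear term exceeds the total
  -- oscillation `2 * |C|`.
  have hp : (ε, 2 * |C| / δ) ∈ affineMajorants f := by
    refine ⟨hε.le, by positivity, fun x y => ?_⟩
    rcases lt_or_ge (dist x y) δ with hxy | hxy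
    · have h1 := (le_abs_self _).trans_lt (H hxy)
      have h2 : 0 ≤ 2 * |C| / δ * dist x y := by positivity
      exact h1.le.trans (le_add_of_nonneg_right h2)
    · have hx := abs_le.1 ((hf x).trans (le_abs_self C))
      have hy := abs_le.1 ((hf y).trans (le_abs_self C))
      have h1 : 2 * |C| / δ * δ ≤ 2 * |C| / δ * dist x y :=
        mul_le_mul_of_nonneg_left hxy (by positivity)
      rw [div_mul_cancel₀ _ hδ.ne'] at h1
      simp only
      linarith
  simpa using concaveModulus_le hp le_rfl

theorem le_uniformRegularization (hf : ∀ x, |f x| ≤ C) (x y : M) :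
    f y - reducedModulus f (dist x y) ≤ uniformRegularization f x := by
  refine le_ciSup (f := fun y => f y - reducedModulus f (dist x y)) ⟨C, ?_⟩ y
  rintro _ ⟨z, rfl⟩
  have h1 := reducedModulus_nonneg hf (dist_nonneg (x := x) (y := z))
  have h2 := (abs_le.1 (hf z)).2
  simp only
  linarith

theorem uniformRegularization_le {x : M} {r : ℝ}
    (hr : ∀ y, f y - reducedModulus f (dist x y) ≤ r) : uniformRegularization f x ≤ r :=
  have : Nonempty M := ⟨x⟩
  ciSup_le hr

theorem abs_uniformRegularization_le (hf : ∀ x, |f x| ≤ C) (x : M) :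
    |uniformRegularization f x| ≤ C := by
  refine abs_le.2 ⟨?_, uniformRegularization_le fun y => ?_⟩
  · have h1 := le_uniformRegularization hf x x
    rw [dist_self, reducedModulus_zero, sub_zero] at h1
    exact (abs_le.1 (hf x)).1.trans h1
  · have h1 := reducedModulus_nonneg hf (dist_nonneg (x := x) (y := y))
    linarith [(abs_le.1 (hf y)).2]

theorem uniformRegularization_sub_le (hf : ∀ x, |f x| ≤ C) (x y : M) :
    uniformRegularization f x - uniformRegularization f y ≤ reducedModulus f (dist x y) := by
  rw [sub_le_iff_le_add]
  refine uniformRegularization_le fun z => ?_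
  have h1 := le_uniformRegularization hf y z
  have h2 := reducedModulus_mono hf dist_nonneg (dist_triangle y x z)
  have h3 := reducedModulus_add_le hf (dist_nonneg (x := y) (y := x))
    (dist_nonneg (x := x) (y := z))
  rw [dist_comm y x] at h2 h3
  linarith

theorem uniformContinuous_uniformRegularization (hf : ∀ x, |f x| ≤ C) :
    UniformContinuous (uniformRegularization f) := by
  refine Metric.uniformContinuous_iff.2 fun ε hε => ?_
  obtain ⟨δ, hδ, H⟩ := exists_reducedModulus_lt hf hε
  refine ⟨δ, hδ, fun {x y} hxy => ?_⟩
  have h1 := uniformRegularization_sub_le hf x y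
  have h2 := uniformRegularization_sub_le hf y x
  rw [dist_comm y x] at h2
  have h3 := H _ dist_nonneg hxy
  rw [Real.dist_eq, abs_lt]
  constructor <;> linarith

theorem uniformRegularization_eq (hf : ∀ x, |f x| ≤ C) (hu : UniformContinuous f) (x : M) :
    uniformRegularization f x = f x := by
  refine le_antisymm (uniformRegularization_le fun y => ?_) ?_
  · have h1 := sub_le_concaveModulus hf y x
    rw [reducedModulus, concaveModulus_zero_of_uniformContinuous hf hu, dist_comm x y]
    linarith
  · simpa only [dist_self, reducedModulus_zero, sub_zero] using le_uniformRegularization hf x x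

/-- In `5 * δ`, one `δ` comes from `f y` and four from the reduced modulus: two for its value at the
distance, two for the subtracted value at `0`. -/
theorem uniformRegularization_le_add {C' : ℝ} (hf : ∀ x, |f x| ≤ C) (hh : ∀ x, |h x| ≤ C')
    {δ : ℝ} (hδ : 0 ≤ δ) (hfh : ∀ x, |f x - h x| ≤ δ) (x : M) :
    uniformRegularization f x ≤ uniformRegularization h x + 5 * δ := by
  refine uniformRegularization_le fun y => ?_
  have h1 := le_uniformRegularization hh x y
  have h2 := reducedModulus_le_add hf hh hδ hfh (dist_nonneg (x := x) (y := y))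
  linarith [(abs_le.1 (hfh y)).2]

theorem abs_uniformRegularization_sub_le {C' : ℝ} (hf : ∀ x, |f x| ≤ C)
    (hh : ∀ x, |h x| ≤ C') {δ : ℝ} (hδ : 0 ≤ δ) (hfh : ∀ x, |f x - h x| ≤ δ) (x : M) :
    |uniformRegularization f x - uniformRegularization h x| ≤ 5 * δ := by
  have h1 := uniformRegularization_le_add hf hh hδ hfh x
  have h2 := uniformRegularization_le_add hh hf hδ
    (fun x => by rw [abs_sub_comm]; exact hfh x) x
  rw [abs_le]
  constructor <;> linarith

end Regularization

theorem abs_lp_infty_apply_le {M : Type*} (f : lp (fun _ : M => ℝ) ∞) (x : M) : |f x| ≤ ‖f‖ :=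
  lp.norm_apply_le_norm ENNReal.top_ne_zero f x

/-- A `5`-Lipschitz retraction of the bounded functions onto the uniformly continuous ones. -/
noncomputable def uniformRetraction {M : Type*} [MetricSpace M] (f : lp (fun _ : M => ℝ) ∞) :
    BddUnifCont M :=
  ⟨BoundedContinuousFunction.ofNormedAddCommGroup (uniformRegularization f)
    (uniformContinuous_uniformRegularization (abs_lp_infty_apply_le f)).continuous ‖f‖
    (abs_uniformRegularization_le (abs_lp_infty_apply_le f)),
    uniformContinuous_uniformRegularization (abs_lp_infty_apply_le f)⟩

theorem norm_uniformRetraction_sub_le {M : Type*} [MetricSpace M] (f h : lp (fun _ : M => ℝ) ∞) :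
    ‖uniformRetraction f - uniformRetraction h‖ ≤ 5 * ‖f - h‖ := by
  rw [Submodule.coe_norm]
  refine (BoundedContinuousFunction.norm_le (by positivity)).2 fun x => ?_
  exact abs_uniformRegularization_sub_le (abs_lp_infty_apply_le f) (abs_lp_infty_apply_le h)
    (norm_nonneg _) (abs_lp_infty_apply_le (f - h)) x

/-- A bounded uniformly continuous function, as a bounded function. -/
noncomputable def bddUnifContToLp {M : Type*} [MetricSpace M] (f : BddUnifCont M) :
    lp (fun _ : M => ℝ) ∞ :=
  ⟨fun x => (f : M →ᵇ ℝ) x, memℓp_infty ⟨‖f‖, by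
    rintro _ ⟨x, rfl⟩
    exact (f : M →ᵇ ℝ).norm_coe_le_norm x⟩⟩

theorem norm_bddUnifContToLp_sub_le {M : Type*} [MetricSpace M] (f h : BddUnifCont M) :
    ‖bddUnifContToLp f - bddUnifContToLp h‖ ≤ ‖f - h‖ :=
  lp.norm_le_of_forall_le (norm_nonneg (f - h : BddUnifCont M)) fun x =>
    ((f - h : BddUnifCont M) : M →ᵇ ℝ).norm_coe_le_norm x

theorem uniformRetraction_bddUnifContToLp {M : Type*} [MetricSpace M] (f : BddUnifCont M) :
    uniformRetraction (bddUnifContToLp f) = f := by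
  ext x
  exact uniformRegularization_eq (abs_lp_infty_apply_le (bddUnifContToLp f)) f.2 x

theorem norm_sub_le_of_lipConst_ne_top {X V : Type*} [MetricSpace X] [NormedAddCommGroup V]
    {f : X → V} (hf : lipConst f ≠ ⊤) (x y : X) :
    ‖f x - f y‖ ≤ (lipConst f).toNNReal * dist x y := by
  rcases eq_or_ne x y with rfl | hxy
  · simp
  have h1 : ENNReal.ofReal (‖f x - f y‖ / dist x y) ≤ lipConst f :=
    le_iSup_of_le x (le_iSup_of_le y (le_iSup_of_le hxy le_rfl))
  rw [ENNReal.ofReal_le_iff_le_toReal hf, div_le_iff₀ (dist_pos.2 hxy)] at h1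
  exact h1

theorem lipConst_le {X V : Type*} [MetricSpace X] [NormedAddCommGroup V] {f : X → V} {K : ℝ≥0}
    (hf : ∀ x y, ‖f x - f y‖ ≤ K * dist x y) : lipConst f ≤ K := by
  refine iSup_le fun x => iSup_le fun y => iSup_le fun hxy => ?_
  refine ENNReal.ofReal_le_of_le_toReal ?_
  rw [div_le_iff₀ (dist_pos.2 hxy)]
  exact hf x y

theorem isLipExtensionBound_bddUnifCont (M : Type u) [MetricSpace M] :
    IsLipExtensionBound.{u, v} (BddUnifCont M) 5 := by
  classical
  intro Z _ X f
  rcases eq_or_ne (lipConst f) ⊤ with htop | htop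
  -- Here the required bound is `5 * ∞ = ∞`, so any extension will do.
  · refine ⟨fun z => if hz : z ∈ X then f ⟨z, hz⟩ else 0, fun x => by simp, ?_⟩
    rw [htop, ENNReal.mul_top (by norm_num)]
    exact le_top
  have hlip : LipschitzOnWith (lipConst f).toNNReal
      (fun z => if hz : z ∈ X then bddUnifContToLp (f ⟨z, hz⟩) else 0) X := by
    refine LipschitzOnWith.of_dist_le_mul fun x hx y hy => ?_
    simp only [hx, hy, dif_pos, dist_eq_norm]
    exact (norm_bddUnifContToLp_sub_le _ _).trans
      (norm_sub_le_of_lipConst_ne_top htop ⟨x, hx⟩ ⟨y, hy⟩)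
  obtain ⟨G, hG, hGX⟩ := hlip.extend_lp_infty
  refine ⟨fun z => uniformRetraction (G z), fun x => ?_, ?_⟩
  · simp only [← hGX x.2, x.2, dif_pos, Subtype.coe_eta, uniformRetraction_bddUnifContToLp]
  · have h1 : lipConst (fun z => uniformRetraction (G z)) ≤
        ((5 * (lipConst f).toNNReal : ℝ≥0) : ℝ≥0∞) := by
      refine lipConst_le fun x y => (norm_uniformRetraction_sub_le _ _).trans ?_
      have h2 := hG.dist_le_mul x y
      rw [dist_eq_norm] at h2
      rw [NNReal.coe_mul, NNReal.coe_ofNat]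
      linarith
    rwa [ENNReal.coe_mul, ENNReal.coe_toNNReal htop] at h1

theorem lipExtensionConst_bddUnifCont_le_five (M : Type u) [MetricSpace M] :
    lipExtensionConst.{u, v} (BddUnifCont M) ≤ 5 :=
  iInf₂_le_of_le 5 (isLipExtensionBound_bddUnifCont M) (by simp)

theorem theorem5p3 (M : Type u) [MetricSpace M] :
    lipExtensionConst.{u, v} (BddUnifCont M) ≤ 37 := by
  exact (lipExtensionConst_bddUnifCont_le_five M).trans (by norm_num)
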